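/- Let $b>0$. Consider $n\ge 1$ bidders who arrive one after another and whose values $v_1,\dots,v_n$ for a single item are drawn independently from the uniform distribution on $[0,b]$ (for instance $[0,1]$). A vector of prices $(p_1,\dots,p_n)\in\mathbb{R}_{\ge 0}^n$ is posted, bidder $i$ is offered price $p_i$, and the item is sold to the first bidder $i$ with $v_i\ge p_i$, at price $p_i$ (if there is no such bidder, the item stays unsold and the revenue is $0$). Let $R^d_n$ be the maximum expected revenue over all price vectors in $\mathbb{R}_{\ge 0}^n$, and let $R^a_n$ be the maximum expected revenue over all vectors $(p,\dots,p)$ with $p\ge 0$, in which the same price is offered to every bidder. Then for every $n\ge 1$ both maxima exist, $R^a_n>0$, and $$\frac{R^d_n}{R^a_n}\le\frac{R^d_{11}}{R^a_{11}}\approx 1.0368,$$ where $\approx$ means equality after rounding to four decimal places, that is, $\left|R^d_{11}/R^a_{11}-1.0368\right|<0.00005$. In particular, the maximum over $n\ge 1$ of the revenue gap $R^d_n/R^a_n$ is attained at $n=11$. -/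

import Mathlib

open MeasureTheory ProbabilityTheory

/-- The uniform distribution on the interval `[0, b]`: Lebesgue measure conditioned on `[0, b]`. -/
noncomputable def uniformLaw (b : ℝ) : Measure ℝ :=
  ProbabilityTheory.cond volume (Set.Icc 0 b)

/-- The event that, under prices `p`, the item is sold to bidder `i`: the value of `i` reaches the
price `p i`, and the value of every earlier bidder was below the price offered to that bidder. -/
def saleEvent {n : ℕ} (p : Fin n → ℝ) (i : Fin n) : Set (Fin n → ℝ) :=
  {v | p i ≤ v i ∧ ∀ j : Fin n, j < i → v j < p j}

/-- The price at which the item is sold when the bidders, arriving in the order of their indices,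
are offered the prices `p` and have values `v` (zero if the item remains unsold). -/
noncomputable def payment {n : ℕ} (p v : Fin n → ℝ) : ℝ :=
  ∑ i : Fin n, (saleEvent p i).indicator (fun _ => p i) v

/-- Expected revenue of the posted-price mechanism with prices `p` when the `n` bidders' values are
independent with common law `μ`. -/
noncomputable def discRevenue (μ : Measure ℝ) {n : ℕ} (p : Fin n → ℝ) : ℝ :=
  ∫ v, payment p v ∂(Measure.pi fun _ : Fin n => μ)

/-- Expected revenue when the same price `p` is offered to all of the `n` bidders. -/
noncomputable def anonRevenue (μ : Measure ℝ) (n : ℕ) (p : ℝ) : ℝ :=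
  discRevenue μ (fun _ : Fin n => p)

/-- Revenues that can be obtained by non-negative discriminatory prices. -/
def discRevenues (μ : Measure ℝ) (n : ℕ) : Set ℝ :=
  (fun p : Fin n → ℝ => discRevenue μ p) '' {p | ∀ i, 0 ≤ p i}

/-- Revenues that can be obtained by a non-negative anonymous price. -/
def anonRevenues (μ : Measure ℝ) (n : ℕ) : Set ℝ :=
  (fun p : ℝ => anonRevenue μ n p) '' {p | 0 ≤ p}

/-- The maximum revenue from discriminatory prices. -/
noncomputable def maxDiscRevenue (μ : Measure ℝ) (n : ℕ) : ℝ :=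
  sSup (discRevenues μ n)

/-- The maximum revenue from anonymous prices. -/
noncomputable def maxAnonRevenue (μ : Measure ℝ) (n : ℕ) : ℝ :=
  sSup (anonRevenues μ n)

/-! Conditioning on the first bidder (`discRevenue_succ`) turns the discriminatory optimum into the
recursion `optRevenue`, while the anonymous optimum is the maximum of `x * (1 - x ^ n)` on `[0, 1]`.
Both scale with `b`, which cancels in the ratio. The constant 1.036755 separates `n = 11` from all
other `n`: the ratio at 11 is at least this, by a tangent bound on the anonymous optimum, and every
other ratio is at most this. For `n < 175` the latter is a finite check on blocks of `n`; beyond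
that, `optRevenue n ≤ 1` and one fixed price suffice. -/

lemma saleEvent_eq_pi {n : ℕ} (p : Fin n → ℝ) (i : Fin n) :
    saleEvent p i = Set.univ.pi fun j =>
      if j < i then Set.Iio (p j) else if j = i then Set.Ici (p j) else Set.univ := by
  ext v
  simp only [saleEvent, Set.mem_ofPred_eq, Set.mem_univ_pi]
  constructor
  · rintro ⟨h, h'⟩ j
    split_ifs with h1 h2
    · exact h' j h1
    · subst h2
      exact h
    · trivial
  · intro h
    refine ⟨by simpa using h i, fun j hj => by simpa [hj] using h j⟩

lemma measurableSet_saleEvent {n : ℕ} (p : Fin n → ℝ) (i : Fin n) :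
    MeasurableSet (saleEvent p i) := by
  rw [saleEvent_eq_pi]
  refine MeasurableSet.univ_pi fun j => ?_
  split_ifs
  · exact measurableSet_Iio
  · exact measurableSet_Ici
  · exact MeasurableSet.univ

lemma discRevenue_eq_sum (μ : Measure ℝ) [IsProbabilityMeasure μ] {n : ℕ} (p : Fin n → ℝ) :
    discRevenue μ p = ∑ i, (∏ j, if j < i then μ.real (Set.Iio (p j)) else
      if j = i then 1 - μ.real (Set.Iio (p j)) else 1) * p i := by
  have hint : ∀ i ∈ Finset.univ, Integrable ((saleEvent p i).indicator fun _ => p i)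
      (Measure.pi fun _ : Fin n => μ) := fun i _ =>
    (integrable_const _).indicator (measurableSet_saleEvent p i)
  simp only [discRevenue, payment]
  rw [integral_finsetSum _ hint]
  refine Finset.sum_congr rfl fun i _ => ?_
  rw [integral_indicator_const _ (measurableSet_saleEvent p i), smul_eq_mul, saleEvent_eq_pi,
    Measure.real, Measure.pi_pi, ENNReal.toReal_prod]
  congr 1
  refine Finset.prod_congr rfl fun j _ => ?_
  split_ifs
  · rfl
  · rw [← Set.compl_Iio, ← probReal_compl_eq_one_sub measurableSet_Iio]
    rfl
  · simp

lemma discRevenue_succ (μ : Measure ℝ) [IsProbabilityMeasure μ] {n : ℕ} (p : Fin (n + 1) → ℝ) :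
    discRevenue μ p = p 0 * (1 - μ.real (Set.Iio (p 0))) +
      μ.real (Set.Iio (p 0)) * discRevenue μ (fun i : Fin n => p i.succ) := by
  rw [discRevenue_eq_sum, discRevenue_eq_sum, Fin.sum_univ_succ, Finset.mul_sum]
  congr 1
  · simp [mul_comm]
  · refine Finset.sum_congr rfl fun i _ => ?_
    simp [Fin.prod_univ_succ, mul_assoc]

lemma anonRevenue_eq (μ : Measure ℝ) [IsProbabilityMeasure μ] (n : ℕ) (p : ℝ) :
    anonRevenue μ n p = p * (1 - μ.real (Set.Iio p) ^ n) := by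
  induction n with
  | zero => simp [anonRevenue, discRevenue, payment]
  | succ n ih =>
    rw [anonRevenue, discRevenue_succ, ← anonRevenue, ih]
    ring

lemma isProbabilityMeasure_uniformLaw {b : ℝ} (hb : 0 < b) :
    IsProbabilityMeasure (uniformLaw b) :=
  cond_isProbabilityMeasure_of_finite (by simp [hb]) (by simp)

lemma uniformLaw_real_Iio {b p : ℝ} (hb : 0 < b) (hp : 0 ≤ p) :
    (uniformLaw b).real (Set.Iio p) = min p b / b := by
  rw [uniformLaw, Measure.real, cond_apply measurableSet_Icc, ENNReal.toReal_mul,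
    ENNReal.toReal_inv, ← Measure.real, ← Measure.real, Real.volume_real_Icc_of_le hb.le, sub_zero]
  rcases le_or_gt p b with h | h
  · have : Set.Icc 0 b ∩ Set.Iio p = Set.Ico 0 p := by
      ext x
      simp only [Set.mem_inter_iff, Set.mem_Icc, Set.mem_Iio, Set.mem_Ico]
      constructor
      · exact fun hx => ⟨hx.1.1, hx.2⟩
      · exact fun hx => ⟨⟨hx.1, hx.2.le.trans h⟩, hx.2⟩
    rw [this, Real.volume_real_Ico_of_le hp, min_eq_left h, sub_zero, inv_mul_eq_div]
  · have : Set.Icc 0 b ∩ Set.Iio p = Set.Icc 0 b :=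
      Set.inter_eq_left.2 fun x hx => hx.2.trans_lt h
    rw [this, Real.volume_real_Icc_of_le hb.le, min_eq_right h.le, sub_zero, inv_mul_eq_div]

/-- The optimal revenue from `n` bidders with values uniform on `[0, 1]`: against the continuation
revenue `r`, the best price is `(1 + r) / 2`. -/
noncomputable def optRevenue : ℕ → ℝ
  | 0 => 0
  | n + 1 => ((1 + optRevenue n) / 2) ^ 2

lemma optRevenue_nonneg (n : ℕ) : 0 ≤ optRevenue n := by
  cases n with
  | zero => exact le_rfl
  | succ n => exact sq_nonneg _

lemma optRevenue_le_one (n : ℕ) : optRevenue n ≤ 1 := by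
  induction n with
  | zero => exact zero_le_one
  | succ n ih =>
    have := optRevenue_nonneg n
    simp only [optRevenue]
    nlinarith

lemma optRevenue_monotone : Monotone optRevenue := by
  refine monotone_nat_of_le_succ fun n => ?_
  simp only [optRevenue]
  nlinarith [sq_nonneg (1 - optRevenue n)]

lemma discRevenue_uniformLaw_le {b : ℝ} (hb : 0 < b) (n : ℕ) (p : Fin n → ℝ) (hp : ∀ i, 0 ≤ p i) :
    discRevenue (uniformLaw b) p ≤ b * optRevenue n := by
  have := isProbabilityMeasure_uniformLaw hb
  induction n with
  | zero => simp [discRevenue, payment, optRevenue]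
  | succ n ih =>
    have ih := ih (fun i => p i.succ) fun i => hp i.succ
    rw [discRevenue_succ, uniformLaw_real_Iio hb (hp 0)]
    rcases le_or_gt (p 0) b with h | h
    · rw [min_eq_left h]
      obtain ⟨x, hx⟩ : ∃ x, p 0 = b * x := ⟨p 0 / b, by field_simp⟩
      have hx0 : 0 ≤ x := nonneg_of_mul_nonneg_right (hx ▸ hp 0) hb
      rw [hx, mul_div_cancel_left₀ x hb.ne']
      calc b * x * (1 - x) + x * discRevenue (uniformLaw b) (fun i => p i.succ)
          ≤ b * x * (1 - x) + x * (b * optRevenue n) := by gcongr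
        _ ≤ b * optRevenue (n + 1) := by
          simp only [optRevenue]
          -- Completing the square: the deficit is exactly `b * (x - (1 + optRevenue n) / 2) ^ 2`.
          nlinarith [mul_nonneg hb.le (sq_nonneg (x - (1 + optRevenue n) / 2))]
    -- A price above `b` almost surely skips the bidder, which cannot beat `n + 1` bidders.
    · rw [min_eq_right h.le, div_self hb.ne', sub_self, mul_zero, zero_add, one_mul]
      exact ih.trans (mul_le_mul_of_nonneg_left (optRevenue_monotone n.le_succ) hb.le)

lemma exists_discRevenue_uniformLaw_eq {b : ℝ} (hb : 0 < b) (n : ℕ) :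
    ∃ p : Fin n → ℝ, (∀ i, 0 ≤ p i) ∧ discRevenue (uniformLaw b) p = b * optRevenue n := by
  have := isProbabilityMeasure_uniformLaw hb
  induction n with
  | zero => exact ⟨0, fun i => le_rfl, by simp [discRevenue, payment, optRevenue]⟩
  | succ n ih =>
    obtain ⟨p, hp, hrev⟩ := ih
    have h0 := optRevenue_nonneg n
    have h1 := optRevenue_le_one n
    have hq : 0 ≤ b * ((1 + optRevenue n) / 2) := by positivity
    refine ⟨Fin.cons (b * ((1 + optRevenue n) / 2)) p, fun i => ?_, ?_⟩
    · refine Fin.cases ?_ (fun j => ?_) i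
      · simpa using hq
      · simpa using hp j
    · rw [discRevenue_succ]
      simp only [Fin.cons_zero, Fin.cons_succ]
      rw [hrev, uniformLaw_real_Iio hb hq, min_eq_left (by nlinarith),
        mul_div_cancel_left₀ _ hb.ne']
      simp only [optRevenue]
      ring

lemma isGreatest_discRevenues_uniformLaw {b : ℝ} (hb : 0 < b) (n : ℕ) :
    IsGreatest (discRevenues (uniformLaw b) n) (b * optRevenue n) := by
  refine ⟨exists_discRevenue_uniformLaw_eq hb n, ?_⟩
  rintro _ ⟨p, hp, rfl⟩
  exact discRevenue_uniformLaw_le hb n p hp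

/-- `a` is the optimal revenue of an anonymous price for `n` values uniform on `[0, 1]`. -/
def IsOptAnonRevenue (n : ℕ) (a : ℝ) : Prop :=
  IsGreatest ((fun x : ℝ => x * (1 - x ^ n)) '' Set.Icc 0 1) a

lemma exists_isOptAnonRevenue (n : ℕ) : ∃ a, IsOptAnonRevenue n a :=
  (isCompact_Icc.image (by fun_prop)).exists_isGreatest
    ((Set.nonempty_Icc.2 zero_le_one).image _)

lemma IsOptAnonRevenue.isGreatest_anonRevenues {b a : ℝ} {n : ℕ} (ha : IsOptAnonRevenue n a)
    (hb : 0 < b) : IsGreatest (anonRevenues (uniformLaw b) n) (b * a) := by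
  have := isProbabilityMeasure_uniformLaw hb
  have key : ∀ x ∈ Set.Icc (0 : ℝ) 1,
      anonRevenue (uniformLaw b) n (b * x) = b * (x * (1 - x ^ n)) := by
    rintro x ⟨h0, h1⟩
    rw [anonRevenue_eq, uniformLaw_real_Iio hb (by positivity),
      min_eq_left (mul_le_of_le_one_right hb.le h1), mul_div_cancel_left₀ _ hb.ne', mul_assoc]
  constructor
  · obtain ⟨x, hx, rfl⟩ := ha.1
    exact ⟨b * x, mul_nonneg hb.le hx.1, key x hx⟩
  · rintro _ ⟨p, hp, rfl⟩
    have hp : 0 ≤ p := hp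
    rcases le_or_gt p b with h | h
    · have hx : p / b ∈ Set.Icc (0 : ℝ) 1 := ⟨by positivity, (div_le_one hb).2 h⟩
      have := key _ hx
      rw [mul_div_cancel₀ p hb.ne'] at this
      simp only [this]
      exact mul_le_mul_of_nonneg_left (ha.2 ⟨_, hx, rfl⟩) hb.le
    · simp only [anonRevenue_eq, uniformLaw_real_Iio hb hp, min_eq_right h.le, div_self hb.ne',
        one_pow, sub_self, mul_zero]
      exact mul_nonneg hb.le (ha.2 ⟨0, by simp, by simp⟩)

lemma IsOptAnonRevenue.pos {n : ℕ} {a : ℝ} (ha : IsOptAnonRevenue n a) (hn : 1 ≤ n) : 0 < a := by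
  have h : (1 / 2 : ℝ) * (1 - (1 / 2) ^ n) ≤ a := ha.2 ⟨1 / 2, by norm_num, rfl⟩
  have : (1 / 2 : ℝ) ^ n < 1 := pow_lt_one₀ (by norm_num) (by norm_num) (by omega)
  linarith

/-- Tangent-line bound for the concave function `x ↦ x * (1 - x ^ 11)`. -/
lemma IsOptAnonRevenue.eleven_le {a : ℝ} (ha : IsOptAnonRevenue 11 a) : a ≤ 0.7313145 := by
  obtain ⟨x, ⟨h0, h1⟩, rfl⟩ := ha.1
  have hx : (0 : ℝ) ≤ x / 0.7977974 := by positivity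
  -- Bernoulli's inequality is the tangent line of `x ^ 12` at 0.7977974, which approximates the
  -- maximiser `12 ^ (-1 / 11)`.
  have := one_add_mul_sub_le_pow (show (-1 : ℝ) ≤ x / 0.7977974 by linarith) 12
  rw [div_pow, le_div_iff₀ (by positivity)] at this
  have hpow : x * (1 - x ^ 11) = x - x ^ 12 := by ring
  simp only [hpow]
  norm_num at this ⊢
  linarith

/-- Fixed-point upper bounds, in units of `10⁻⁸`, for `optRevenue`. -/
def gridBound : ℕ → ℕ
  | 0 => 0
  | n + 1 => (10 ^ 8 + gridBound n) ^ 2 / (4 * 10 ^ 8) + 1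

lemma optRevenue_le_gridBound (n : ℕ) : optRevenue n ≤ gridBound n / 10 ^ 8 := by
  induction n with
  | zero => simp [optRevenue, gridBound]
  | succ n ih =>
    have h0 := optRevenue_nonneg n
    have h := (Nat.lt_div_mul_add (a := (10 ^ 8 + gridBound n) ^ 2) (b := 4 * 10 ^ 8)
      (by norm_num)).le
    have h' : ((10 ^ 8 + gridBound n : ℝ)) ^ 2 ≤ gridBound (n + 1) * (4 * 10 ^ 8) := by
      rw [gridBound, Nat.cast_add, add_mul, Nat.cast_one, one_mul]
      exact_mod_cast h
    calc optRevenue (n + 1) = ((1 + optRevenue n) / 2) ^ 2 := rfl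
      _ ≤ ((1 + gridBound n / 10 ^ 8) / 2) ^ 2 := by gcongr
      _ = (10 ^ 8 + gridBound n : ℝ) ^ 2 / (4 * 10 ^ 8) / 10 ^ 8 := by ring
      _ ≤ gridBound (n + 1) / 10 ^ 8 := by
        gcongr
        rwa [div_le_iff₀ (by norm_num)]

/-- For `k ∈ [n, m]`, the price `P / 1000` shows that the revenue gap is at most `1.036755`. -/
def IsGapCertificate (t : ℕ × ℕ × ℕ) : Prop :=
  t.2.2 ≤ 1000 ∧ gridBound t.2.1 * 1000 ^ (t.1 + 1) * 10 ^ 6 ≤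
    1036755 * 10 ^ 8 * (t.2.2 * (1000 ^ t.1 - t.2.2 ^ t.1))

instance : DecidablePred IsGapCertificate := fun _ => inferInstanceAs (Decidable (_ ∧ _))

lemma IsOptAnonRevenue.mul_le {n k : ℕ} {a p : ℝ} (ha : IsOptAnonRevenue k a) (hn : n ≤ k)
    (h0 : 0 ≤ p) (h1 : p ≤ 1) : p * (1 - p ^ n) ≤ a :=
  calc p * (1 - p ^ n) ≤ p * (1 - p ^ k) := by
        gcongr p * (1 - ?_)
        exact pow_le_pow_of_le_one h0 h1 hn
    _ ≤ a := ha.2 ⟨p, ⟨h0, h1⟩, rfl⟩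

/-- Both optima grow with the number of bidders, so a block is settled by the discriminatory bound
at its right end and the anonymous revenue at its left end. -/
lemma IsGapCertificate.optRevenue_le {n m P k : ℕ} {a : ℝ} (h : IsGapCertificate (n, m, P))
    (ha : IsOptAnonRevenue k a) (hn : n ≤ k) (hm : k ≤ m) : optRevenue k ≤ 1.036755 * a := by
  obtain ⟨hP, h⟩ := h
  simp only at hP h
  have h1 : (P : ℝ) / 1000 ≤ 1 := by
    rw [div_le_one (by norm_num)]
    exact_mod_cast hP
  have hle := ha.mul_le hn (by positivity) h1
  have h : (gridBound m : ℝ) * 1000 ^ (n + 1) * 10 ^ 6 ≤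
      1036755 * 10 ^ 8 * (P * (1000 ^ n - P ^ n)) := by
    have := (Nat.cast_le (α := ℝ)).2 h
    rw [Nat.cast_mul, Nat.cast_mul _ (P * _), Nat.cast_mul P, Nat.cast_sub (by gcongr)] at this
    exact_mod_cast this
  calc optRevenue k ≤ gridBound m / 10 ^ 8 :=
        (optRevenue_monotone hm).trans (optRevenue_le_gridBound m)
    _ = gridBound m * 1000 ^ (n + 1) * 10 ^ 6 / (1000 ^ (n + 1) * 10 ^ 14) := by field_simp
    _ ≤ 1036755 * 10 ^ 8 * (P * (1000 ^ n - P ^ n)) / (1000 ^ (n + 1) * 10 ^ 14) := by gcongr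
    _ = 1.036755 * (P / 1000 * (1 - (P / 1000) ^ n)) := by
      rw [div_pow]
      field_simp
      ring
    _ ≤ 1.036755 * a := by gcongr

/-- Blocks `[n, m]` with prices `P / 1000` that bound the gap for the numbers of bidders in them. -/
def gapCertificates : List (ℕ × ℕ × ℕ) :=
  [(1, 1, 500), (2, 2, 577), (3, 3, 630), (4, 4, 669), (5, 5, 699), (6, 6, 723), (7, 7, 743),
   (8, 8, 760), (9, 9, 774), (10, 10, 787), (12, 12, 808), (13, 13, 816), (14, 14, 824), (15,
   15, 831), (16, 16, 838), (17, 17, 844), (18, 18, 849), (19, 19, 854), (20, 20, 859), (21, 21,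
   863), (22, 22, 867), (23, 23, 871), (24, 24, 874), (25, 25, 878), (26, 26, 881), (27, 28,
   880), (29, 30, 881), (31, 32, 883), (33, 35, 893), (36, 39, 902), (40, 44, 906), (45, 51,
   914), (52, 62, 923), (63, 82, 934), (83, 130, 946), (131, 174, 944)]

lemma isGapCertificate_of_mem : ∀ t ∈ gapCertificates, IsGapCertificate t := by
  decide +kernel

lemma exists_mem_gapCertificates :
    ∀ k < 175, 1 ≤ k → k ≠ 11 → ∃ t ∈ gapCertificates, t.1 ≤ k ∧ k ≤ t.2.1 := by
  decide +kernel

lemma IsOptAnonRevenue.optRevenue_le {k : ℕ} {a : ℝ} (ha : IsOptAnonRevenue k a) (hk : 1 ≤ k)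
    (h11 : k ≠ 11) : optRevenue k ≤ 1.036755 * a := by
  rcases lt_or_ge k 175 with h | h
  · obtain ⟨t, ht, h1, h2⟩ := exists_mem_gapCertificates k h hk h11
    exact (isGapCertificate_of_mem t ht).optRevenue_le ha h1 h2
  -- Already with 175 bidders, price 0.972 earns more than `1 / 1.036755`.
  · have := ha.mul_le h (p := 0.972) (by norm_num) (by norm_num)
    have h1 := optRevenue_le_one k
    norm_num at this ⊢
    linarith

lemma le_optRevenue_eleven : 0.758196 ≤ optRevenue 11 := by
  norm_num [optRevenue]

lemma optRevenue_eleven_le : optRevenue 11 ≤ 0.758198 := by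
  norm_num [optRevenue]

theorem mainTheorem8 (b : ℝ) (hb : 0 < b) :
    (∀ n : ℕ, 1 ≤ n →
      IsGreatest (discRevenues (uniformLaw b) n) (maxDiscRevenue (uniformLaw b) n) ∧
      IsGreatest (anonRevenues (uniformLaw b) n) (maxAnonRevenue (uniformLaw b) n) ∧
      0 < maxAnonRevenue (uniformLaw b) n ∧
      maxDiscRevenue (uniformLaw b) n / maxAnonRevenue (uniformLaw b) n ≤
        maxDiscRevenue (uniformLaw b) 11 / maxAnonRevenue (uniformLaw b) 11) ∧
    |maxDiscRevenue (uniformLaw b) 11 / maxAnonRevenue (uniformLaw b) 11 - 1.0368| < 0.00005 := by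
  choose a ha using exists_isOptAnonRevenue
  have hD := fun n => isGreatest_discRevenues_uniformLaw hb n
  have hA := fun n => (ha n).isGreatest_anonRevenues hb
  have hDeq : ∀ n, maxDiscRevenue (uniformLaw b) n = b * optRevenue n := fun n => (hD n).csSup_eq
  have hAeq : ∀ n, maxAnonRevenue (uniformLaw b) n = b * a n := fun n => (hA n).csSup_eq
  have hpos : 0 < a 11 := (ha 11).pos (by norm_num)
  have hle := (ha 11).eleven_le
  -- A near-optimal price bounds `a 11` from below, for the upper estimate of the ratio.
  have hge := (ha 11).mul_le le_rfl (p := 0.7978) (by norm_num) (by norm_num)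
  have hr := le_optRevenue_eleven
  have hr' := optRevenue_eleven_le
  simp only [hDeq, hAeq, mul_div_mul_left _ _ hb.ne']
  refine ⟨fun n hn => ⟨hD n, hA n, mul_pos hb ((ha n).pos hn), ?_⟩, ?_⟩
  · rcases eq_or_ne n 11 with rfl | h11
    · exact le_rfl
    · calc optRevenue n / a n ≤ 1.036755 :=
            (div_le_iff₀ ((ha n).pos hn)).2 ((ha n).optRevenue_le hn h11)
        _ ≤ optRevenue 11 / a 11 := by
          rw [le_div_iff₀ hpos]
          linarith
  · have h1 : 1.036755 ≤ optRevenue 11 / a 11 := by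
      rw [le_div_iff₀ hpos]
      linarith
    have h2 : optRevenue 11 / a 11 ≤ 1.0368 := by
      rw [div_le_iff₀ hpos]
      norm_num at hge hr' ⊢
      linarith
    rw [abs_lt]
    constructor <;> linarith
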